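/- Let $D\ge 1$ and let $\Omega\subset\mathbb{R}^D$ be a bounded open set (no connectedness or boundary regularity is needed). Let $(\rho_n)$ be a sequence of radial functions $\rho_n:\mathbb{R}^D\to\mathbb{R}$ (i.e. $\rho_n(x)$ depends only on the Euclidean norm $\|x\|$) with $\rho_n\ge 0$, $\int_{\mathbb{R}^D}\rho_n=1$, and $\lim_{n\to\infty}\int_{\|x\|>\delta}\rho_n(x)\,dx=0$ for every $\delta>0$. The nonlocal gradient of $u:\Omega\to\mathbb{R}$ at $x\in\Omega$ is the principal value $$\nabla_n u(x):=D\lim_{\epsilon\to0^+}\int_{\Omega\setminus B_\epsilon(x)}\frac{u(x)-u(y)}{\|x-y\|}\,\frac{x-y}{\|x-y\|}\,\rho_n(x-y)\,dy .$$ We say that it exists at $x$ if each truncated integral converges absolutely and the limit exists. Put $$A(x_0,x)=u(x_0)+(x-x_0)^T\nabla u(x_0),\qquad r(x_0,x)=u(x)-A(x_0,x),$$ $$A_n(x_0,x)=u(x_0)+(x-x_0)^T\nabla_n u(x_0),\qquad r_n(x_0,x)=u(x)-A_n(x_0,x).$$ 1. If $u\in C^1_c(\Omega)$ (continuously differentiable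 on $\Omega$ with compact support in $\Omega$), then $\nabla_n u(x)$ exists for all $n$ and all $x\in\Omega$, and $A_n\to A$ and $r_n\to r$ uniformly on $\Omega\times\Omega$ as $n\to\infty$. 2. If $u\in H^1_0(\Omega)$ (the closure of $C^\infty_c(\Omega)$ in $H^1(\Omega)$), and $\nabla u$ in the definition of $A$ and $r$ is the weak gradient, then for every $n$ the nonlocal gradient $\nabla_n u(x)$ exists for almost every $x\in\Omega$, $r_n-r\in L^2(\Omega\times\Omega)$, and $\|r_n-r\|_{L^2(\Omega\times\Omega)}\to0$ as $n\to\infty$. -/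

import Mathlib

open MeasureTheory Filter Topology Set Metric
open scoped ContDiff

noncomputable section

namespace NonlocalTaylor

/-- `ℝ^D` with the Euclidean norm and inner product. -/
abbrev E (D : ℕ) : Type := EuclideanSpace ℝ (Fin D)

variable {D : ℕ}

/-! ### Kernels -/

/-- A radial probability density on `ℝ^D`. (An integral equal to `1` forces integrability, because
the Bochner integral of a non-integrable function is `0`.) -/
structure IsRadialDensity (ρ : E D → ℝ) : Prop where
  nonneg : ∀ x, 0 ≤ ρ x
  radial : ∃ ρhat : ℝ → ℝ, ∀ x, ρ x = ρhat ‖x‖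
  integral_eq_one : ∫ x, ρ x = 1

/-- A sequence of radial probability densities whose mass concentrates at the origin. -/
structure IsKernelSequence (ρ : ℕ → E D → ℝ) : Prop where
  density : ∀ n, IsRadialDensity (ρ n)
  tail : ∀ δ : ℝ, 0 < δ → Tendsto (fun n => ∫ x in {x : E D | δ < ‖x‖}, ρ n x) atTop (𝓝 0)

/-! ### The nonlocal gradient

Functions on `Ω` are represented by functions on the whole space; nothing below depends on the
values that `u` takes outside `Ω` as long as the base points lie in `Ω`. -/

/-- The integrand `(u x - u y) / ‖x - y‖ * ρ (x - y) • (x - y) / ‖x - y‖`. -/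
def nonlocalIntegrand (ρ : E D → ℝ) (u : E D → ℝ) (x y : E D) : E D :=
  ((u x - u y) / ‖x - y‖ * ρ (x - y)) • (‖x - y‖⁻¹ • (x - y))

/-- `D` times the integral of `nonlocalIntegrand` over the points of `Ω` at distance at least `ε`
from `x`. -/
def truncatedGradient (ρ : E D → ℝ) (Ω : Set (E D)) (u : E D → ℝ) (x : E D) (ε : ℝ) : E D :=
  (D : ℝ) • ∫ y in Ω \ ball x ε, nonlocalIntegrand ρ u x y

/-- `v` is the nonlocal gradient of `u` at `x`: the truncated integrals converge absolutely, and
they tend to `v` as `ε → 0+` (the principal value integral exists and is equal to `v`). -/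
def HasNonlocalGradientAt (ρ : E D → ℝ) (Ω : Set (E D)) (u : E D → ℝ) (x v : E D) : Prop :=
  (∀ ε : ℝ, 0 < ε → IntegrableOn (nonlocalIntegrand ρ u x) (Ω \ ball x ε)) ∧
    Tendsto (truncatedGradient ρ Ω u x) (𝓝[>] 0) (𝓝 v)

/-- The nonlocal gradient `∇_ρ u (x)`, as a principal value. -/
def nonlocalGradient (ρ : E D → ℝ) (Ω : Set (E D)) (u : E D → ℝ) (x : E D) : E D :=
  limUnder (𝓝[>] (0 : ℝ)) (truncatedGradient ρ Ω u x)

/-! ### Affine approximants and remainders -/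

/-- `u(x₀) + (x - x₀)ᵀ G(x₀)`: the affine approximant of `u` at `x₀` for a gradient field `G`
(the classical, the weak, or the nonlocal gradient of `u`). -/
def affineApprox (u : E D → ℝ) (G : E D → E D) (x₀ x : E D) : ℝ :=
  u x₀ + inner ℝ (x - x₀) (G x₀)

/-- The remainder `u(x) - A(x₀, x)` of the affine approximant. -/
def remainder (u : E D → ℝ) (G : E D → E D) (x₀ x : E D) : ℝ :=
  u x - affineApprox u G x₀ x

/-! ### Function spaces -/

/-- `u ∈ C¹_c(Ω)`: `u` is continuously differentiable on the open set `Ω` and vanishes on `Ω`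
outside some compact subset of `Ω`. -/
def MemC1c (Ω : Set (E D)) (u : E D → ℝ) : Prop :=
  ContDiffOn ℝ 1 u Ω ∧ ∃ K : Set (E D), IsCompact K ∧ K ⊆ Ω ∧ ∀ x ∈ Ω \ K, u x = 0

/-- `φ ∈ C^∞_c(Ω)`. -/
def IsTestFunction (Ω : Set (E D)) (φ : E D → ℝ) : Prop :=
  ContDiff ℝ ∞ φ ∧ HasCompactSupport φ ∧ tsupport φ ⊆ Ω

/-- `G` is a weak (distributional) gradient of `u` on `Ω`. -/
def IsWeakGradient (Ω : Set (E D)) (u : E D → ℝ) (G : E D → E D) : Prop :=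
  LocallyIntegrableOn u Ω ∧ LocallyIntegrableOn G Ω ∧
    ∀ φ : E D → ℝ, IsTestFunction Ω φ →
      ∫ x in Ω, u x • gradient φ x = - ∫ x in Ω, φ x • G x

/-- `u ∈ H¹₀(Ω)`: `u` lies in `L²(Ω)`, has a weak gradient `G` in `L²(Ω)`, and is the limit, in the
norm of `H¹(Ω)`, of a sequence in `C^∞_c(Ω)`. -/
def MemH10 (Ω : Set (E D)) (u : E D → ℝ) : Prop :=
  MemLp u 2 (volume.restrict Ω) ∧
    ∃ G : E D → E D, MemLp G 2 (volume.restrict Ω) ∧ IsWeakGradient Ω u G ∧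
      ∃ φ : ℕ → E D → ℝ, (∀ k, IsTestFunction Ω (φ k)) ∧
        Tendsto (fun k => eLpNorm (fun x => φ k x - u x) 2 (volume.restrict Ω)) atTop (𝓝 0) ∧
        Tendsto (fun k => eLpNorm (fun x => gradient (φ k) x - G x) 2 (volume.restrict Ω))
          atTop (𝓝 0)

end NonlocalTaylor

end

/-! Radial symmetry makes the direction `z / ‖z‖`, weighted by `ρ`, have second moment matrix `I /
D`. The factor `D` therefore makes the linearised kernel, integrated over the whole space, return
the gradient exactly (`IsRadialDensity.integral_moment`).

For `u ∈ C¹_c(Ω)`, extended by zero, the difference quotient differs from its linearisation by at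
most `ε` when `‖x - y‖ ≤ δ`, uniformly in `x`, and by at most twice the Lipschitz constant
elsewhere. The kernel has vanishing mass beyond `δ`, so `∇ₙu → ∇u` uniformly.

For `u ∈ H¹₀(Ω)`, the estimate `‖U - U(· - z)‖₂ ≤ ‖z‖ ‖G‖₂` for the zero extension `U`, with Jensen
for the probability measure `ρ dz` and Tonelli, gives `‖∇ₙu‖₂ ≤ D ‖G‖₂`
(`IsTestLimit.eLpNorm_nonlocalGradient_le`). This bound is independent of `n`, so density of test
functions carries the smooth case over to `H¹₀`.

In both cases the integrand is absolutely integrable up to the singularity (at almost every `x` in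
the second), so the principal value is an ordinary integral. The passage to `A` and `r` uses only
that `x - x₀` is bounded on `Ω × Ω`. -/

namespace NonlocalTaylor

variable {D : ℕ} {ρ : E D → ℝ} {Ω : Set (E D)} {u v : E D → ℝ} {x : E D}

/-! ### Radial densities -/

namespace IsRadialDensity

lemma integrable (hρ : IsRadialDensity ρ) : Integrable ρ :=
  Integrable.of_integral_ne_zero (by rw [hρ.integral_eq_one]; exact one_ne_zero)

lemma apply_linearIsometryEquiv (hρ : IsRadialDensity ρ) (R : E D ≃ₗᵢ[ℝ] E D) (z : E D) :
    ρ (R z) = ρ z := by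
  obtain ⟨f, hf⟩ := hρ.radial
  rw [hf, hf, R.norm_map]

lemma lintegral_ofReal (hρ : IsRadialDensity ρ) : ∫⁻ z, ENNReal.ofReal (ρ z) = 1 := by
  rw [← ofReal_integral_eq_lintegral_ofReal hρ.integrable (.of_forall hρ.nonneg),
    hρ.integral_eq_one, ENNReal.ofReal_one]

lemma norm_inv_norm_smul_le (z : E D) : ‖‖z‖⁻¹ • z‖ ≤ 1 := by
  rw [norm_smul, norm_inv, norm_norm]
  exact inv_mul_le_one

lemma abs_inner_inv_norm_smul_le (a z : E D) : |inner ℝ a (‖z‖⁻¹ • z)| ≤ ‖a‖ :=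
  (abs_real_inner_le_norm _ _).trans
    (mul_le_of_le_one_right (norm_nonneg _) (norm_inv_norm_smul_le z))

lemma integrable_mul_inner_sq (hρ : IsRadialDensity ρ) (a : E D) :
    Integrable fun z => ρ z * inner ℝ a (‖z‖⁻¹ • z) ^ 2 := by
  refine hρ.integrable.mul_bdd (c := ‖a‖ ^ 2)
    (Measurable.aestronglyMeasurable (by fun_prop)) (.of_forall fun z => ?_)
  rw [norm_pow]
  exact pow_le_pow_left₀ (norm_nonneg _) (abs_inner_inv_norm_smul_le a z) 2

/-- The reflection exchanging `a` and `b` preserves both Lebesgue measure and `ρ`. -/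
lemma integral_mul_inner_sq_congr (hρ : IsRadialDensity ρ) {a b : E D} (h : ‖a‖ = ‖b‖) :
    ∫ z, ρ z * inner ℝ a (‖z‖⁻¹ • z) ^ 2 = ∫ z, ρ z * inner ℝ b (‖z‖⁻¹ • z) ^ 2 := by
  set R := (ℝ ∙ (a - b))ᗮ.reflection with hR
  have hab : R a = b := Submodule.reflection_sub h
  have := R.measurePreserving.integral_comp R.toHomeomorph.measurableEmbedding
    (fun z => ρ z * inner ℝ b (‖z‖⁻¹ • z) ^ 2)
  rw [← this]
  refine integral_congr_ae (.of_forall fun z => ?_)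
  simp only [hρ.apply_linearIsometryEquiv, R.norm_map]
  rw [← map_smul, ← hab, R.inner_map_map]

/-- Only `‖a‖` matters, so `a` may be replaced by `‖a‖ • b i` for each vector of an orthonormal
basis. Summing over the `D` choices, Parseval turns the squares into the squared norm of a unit
vector. -/
lemma integral_mul_inner_sq (hD : 0 < D) (hρ : IsRadialDensity ρ) (a : E D) :
    D * ∫ z, ρ z * inner ℝ a (‖z‖⁻¹ • z) ^ 2 = ‖a‖ ^ 2 := by
  have : Nonempty (Fin D) := ⟨⟨0, hD⟩⟩
  set b := EuclideanSpace.basisFun (Fin D) ℝ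
  have key (i : Fin D) : ∫ z, ρ z * inner ℝ a (‖z‖⁻¹ • z) ^ 2
      = ∫ z, ‖a‖ ^ 2 * (ρ z * inner ℝ (‖z‖⁻¹ • z) (b i) ^ 2) := by
    rw [hρ.integral_mul_inner_sq_congr (a := a) (b := ‖a‖ • b i) (by simp [norm_smul])]
    congr 1 with z
    rw [real_inner_smul_left, real_inner_comm]
    ring
  have hsum : ∑ i, ∫ z, ‖a‖ ^ 2 * (ρ z * inner ℝ (‖z‖⁻¹ • z) (b i) ^ 2) = ‖a‖ ^ 2 := by
    rw [← integral_finsetSum _ fun i _ => ?_]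
    · have h : (fun z => ∑ i, ‖a‖ ^ 2 * (ρ z * inner ℝ (‖z‖⁻¹ • z) (b i) ^ 2))
          =ᵐ[volume] fun z => ‖a‖ ^ 2 * ρ z := by
        -- The direction has norm one only off the origin, a null set since `0 < D`.
        have h0 : ∀ᵐ z : E D, z ≠ 0 := by simp [ae_iff]
        filter_upwards [h0] with z hz
        rw [← Finset.mul_sum, ← Finset.mul_sum, b.sum_sq_inner_left, norm_smul, norm_inv,
          norm_norm, inv_mul_cancel₀ (norm_ne_zero_iff.2 hz)]
        ring
      rw [integral_congr_ae h, integral_const_mul, hρ.integral_eq_one, mul_one]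
    · refine ((hρ.integrable_mul_inner_sq (b i)).congr (.of_forall fun z => ?_)).const_mul _
      simp only [real_inner_comm]
  rw [← hsum, ← Finset.sum_congr rfl fun i _ => key i]
  simp

lemma integrable_moment (hρ : IsRadialDensity ρ) (a : E D) :
    Integrable fun z => (inner ℝ a (‖z‖⁻¹ • z) * ρ z) • (‖z‖⁻¹ • z) := by
  have h : Integrable fun z => inner ℝ a (‖z‖⁻¹ • z) * ρ z :=
    hρ.integrable.bdd_mul (c := ‖a‖) (Measurable.aestronglyMeasurable (by fun_prop))
      (.of_forall fun z => abs_inner_inv_norm_smul_le a z)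
  refine h.smul_bdd 1 (Measurable.aestronglyMeasurable (by fun_prop))
    (.of_forall norm_inv_norm_smul_le)

/-- The second moments of the direction of a radial density are those of the uniform
distribution on the sphere. -/
lemma integral_moment (hD : 0 < D) (hρ : IsRadialDensity ρ) (a : E D) :
    (D : ℝ) • ∫ z, (inner ℝ a (‖z‖⁻¹ • z) * ρ z) • (‖z‖⁻¹ • z) = a := by
  refine ext_inner_left ℝ fun b => ?_
  rw [real_inner_smul_right, ← integral_inner (hρ.integrable_moment a)]
  -- Polarisation recovers the bilinear form from the quadratic one.
  have h1 := hρ.integral_mul_inner_sq hD (a + b)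
  have h2 := hρ.integral_mul_inner_sq hD (a - b)
  have h3 : ∫ z, inner ℝ b ((inner ℝ a (‖z‖⁻¹ • z) * ρ z) • (‖z‖⁻¹ • z))
      = ((∫ z, ρ z * inner ℝ (a + b) (‖z‖⁻¹ • z) ^ 2)
        - ∫ z, ρ z * inner ℝ (a - b) (‖z‖⁻¹ • z) ^ 2) / 4 := by
    rw [← integral_sub (hρ.integrable_mul_inner_sq _) (hρ.integrable_mul_inner_sq _),
      ← integral_div]
    congr 1 with z
    rw [real_inner_smul_right, inner_add_left, inner_sub_left]
    ring
  have h4 := real_inner_eq_norm_mul_self_add_norm_mul_self_sub_norm_sub_mul_self_div_two a b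
  have h5 := norm_add_sq_real a b
  have h6 := norm_sub_sq_real a b
  rw [h3, real_inner_comm]
  linarith

lemma integrable_comp_sub_left (hρ : IsRadialDensity ρ) (x : E D) :
    Integrable fun y => ρ (x - y) := hρ.integrable.comp_sub_left x

end IsRadialDensity

/-! ### Absolutely convergent nonlocal gradients -/

@[simp]
lemma nonlocalIntegrand_self : nonlocalIntegrand ρ u x x = 0 := by simp [nonlocalIntegrand]

lemma norm_nonlocalIntegrand_le (hρ : IsRadialDensity ρ) (x y : E D) :
    ‖nonlocalIntegrand ρ u x y‖ ≤ |u x - u y| / ‖x - y‖ * ρ (x - y) := by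
  rw [nonlocalIntegrand, norm_smul, norm_mul, norm_div, norm_norm, Real.norm_eq_abs,
    Real.norm_of_nonneg (hρ.nonneg _)]
  exact mul_le_of_le_one_right (mul_nonneg (by positivity) (hρ.nonneg _))
    (IsRadialDensity.norm_inv_norm_smul_le _)

lemma nonlocalIntegrand_sub (y : E D) : nonlocalIntegrand ρ (fun z => u z - v z) x y
    = nonlocalIntegrand ρ u x y - nonlocalIntegrand ρ v x y := by
  rw [nonlocalIntegrand, nonlocalIntegrand, nonlocalIntegrand, ← sub_smul]
  congr 1
  ring

/-- Dominated convergence, with the untruncated integrand as its own majorant. -/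
lemma tendsto_truncatedGradient (h : IntegrableOn (nonlocalIntegrand ρ u x) Ω) :
    Tendsto (truncatedGradient ρ Ω u x) (𝓝[>] 0)
      (𝓝 ((D : ℝ) • ∫ y in Ω, nonlocalIntegrand ρ u x y)) := by
  refine Tendsto.const_smul ?_ _
  have hrw (ε : ℝ) : ∫ y in Ω \ ball x ε, nonlocalIntegrand ρ u x y
      = ∫ y in Ω, (ball x ε)ᶜ.indicator (nonlocalIntegrand ρ u x) y := by
    rw [setIntegral_indicator measurableSet_ball.compl, sdiff_eq]
  simp_rw [hrw]
  refine tendsto_integral_filter_of_dominated_convergence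
    (fun y => ‖nonlocalIntegrand ρ u x y‖)
    (.of_forall fun ε => h.aestronglyMeasurable.indicator measurableSet_ball.compl)
    (.of_forall fun ε => .of_forall fun y => norm_indicator_le_norm_self _ _) h.norm
    (.of_forall fun y => ?_)
  -- At `y = x` the integrand is zero, so truncation has no effect there.
  rcases eq_or_ne y x with rfl | hy
  · refine tendsto_const_nhds.congr fun ε => ?_
    by_cases hε : y ∈ (ball y ε)ᶜ <;> simp [hε]
  · refine tendsto_const_nhds.congr' ?_
    have : ∀ᶠ ε in 𝓝[>] (0 : ℝ), ε < dist y x :=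
      nhdsWithin_le_nhds (eventually_lt_nhds (dist_pos.2 hy))
    filter_upwards [this] with ε hε
    rw [indicator_of_mem]
    simpa using hε.le

lemma nonlocalGradient_eq_integral (h : IntegrableOn (nonlocalIntegrand ρ u x) Ω) :
    nonlocalGradient ρ Ω u x = (D : ℝ) • ∫ y in Ω, nonlocalIntegrand ρ u x y :=
  (tendsto_truncatedGradient h).limUnder_eq

lemma hasNonlocalGradientAt_of_integrableOn
    (h : IntegrableOn (nonlocalIntegrand ρ u x) Ω) :
    HasNonlocalGradientAt ρ Ω u x (nonlocalGradient ρ Ω u x) := by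
  refine ⟨fun ε _ => h.mono_set sdiff_subset, ?_⟩
  rw [nonlocalGradient_eq_integral h]
  exact tendsto_truncatedGradient h

lemma nonlocalIntegrand_congr (huv : EqOn u v Ω) (hx : x ∈ Ω) :
    EqOn (nonlocalIntegrand ρ u x) (nonlocalIntegrand ρ v x) Ω := fun y hy => by
  rw [nonlocalIntegrand, nonlocalIntegrand, huv hx, huv hy]

lemma aestronglyMeasurable_nonlocalIntegrand (hρ : IsRadialDensity ρ)
    (hu : AEStronglyMeasurable u (volume.restrict Ω)) (x : E D) :
    AEStronglyMeasurable (nonlocalIntegrand ρ u x) (volume.restrict Ω) := by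
  have h1 : AEStronglyMeasurable (fun y => ρ (x - y)) (volume.restrict Ω) :=
    (hρ.integrable_comp_sub_left x).aestronglyMeasurable.restrict
  have h2 : AEStronglyMeasurable (fun y : E D => ‖x - y‖⁻¹) (volume.restrict Ω) :=
    Measurable.aestronglyMeasurable (by fun_prop)
  have h3 : AEStronglyMeasurable (fun y : E D => x - y) (volume.restrict Ω) :=
    Measurable.aestronglyMeasurable (by fun_prop)
  unfold nonlocalIntegrand
  simp_rw [div_eq_mul_inv]
  exact (((aestronglyMeasurable_const.sub hu).mul h2).mul h1).smul (h2.smul h3)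

/-! ### Continuously differentiable functions -/

lemma inner_gradient (u : E D → ℝ) (x z : E D) : inner ℝ (gradient u x) z = fderiv ℝ u x z :=
  inner_gradient_left

lemma norm_gradient (u : E D → ℝ) (x : E D) : ‖gradient u x‖ = ‖fderiv ℝ u x‖ :=
  LinearIsometryEquiv.norm_map _ _

lemma integrable_nonlocalIntegrand_of_contDiff (hρ : IsRadialDensity ρ) (hu : ContDiff ℝ 1 u)
    (hc : HasCompactSupport u) (x : E D) : Integrable (nonlocalIntegrand ρ u x) := by
  obtain ⟨L, hL⟩ := hu.lipschitzWith_of_hasCompactSupport hc one_ne_zero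
  refine ((hρ.integrable_comp_sub_left x).const_mul L).mono' ?_ (.of_forall fun y => ?_)
  · rw [← Measure.restrict_univ (μ := volume)]
    exact aestronglyMeasurable_nonlocalIntegrand hρ hu.continuous.aestronglyMeasurable x
  · refine (norm_nonlocalIntegrand_le hρ x y).trans ?_
    gcongr
    · exact hρ.nonneg _
    · refine div_le_of_le_mul₀ (norm_nonneg _) L.2 ?_
      simpa [dist_eq_norm] using hL.dist_le_mul x y

/-- The error of the linearisation is `o(‖x - y‖)`, uniformly. -/
lemma exists_forall_abs_sub_fderiv_le (hu : ContDiff ℝ 1 u) (hc : HasCompactSupport u) {ε : ℝ}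
    (hε : 0 < ε) : ∃ δ > 0, ∀ x y : E D, ‖x - y‖ ≤ δ →
      |u x - u y - fderiv ℝ u x (x - y)| ≤ ε * ‖x - y‖ := by
  have huc : UniformContinuous (fderiv ℝ u) :=
    (hc.fderiv ℝ).uniformContinuous_of_continuous (hu.continuous_fderiv one_ne_zero)
  obtain ⟨δ, hδ, h⟩ := Metric.uniformContinuous_iff.1 huc ε hε
  -- Half of `δ`: uniform continuity needs a strict inequality, while the mean value inequality is
  -- applied on a closed ball.
  refine ⟨δ / 2, by positivity, fun x y hxy => ?_⟩
  have := (convex_closedBall x (δ / 2)).norm_image_sub_le_of_norm_hasFDerivWithin_le'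
    (f := u) (f' := fderiv ℝ u) (φ := fderiv ℝ u x) (C := ε) (x := y) (y := x)
    (fun z _ => ((hu.differentiable one_ne_zero) z).hasFDerivAt.hasFDerivWithinAt)
    (fun z hz => ?_) (by simpa [dist_eq_norm, norm_sub_rev] using hxy)
    (mem_closedBall_self (by positivity))
  · simpa using this
  · rw [← dist_eq_norm]
    refine (h ?_).le
    rw [mem_closedBall] at hz
    linarith

/-- Comparison of the nonlocal integrand on `Ω` with its linearisation. -/
lemma exists_forall_norm_indicator_sub_le (hΩ : IsOpen Ω) (hu : ContDiff ℝ 1 u)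
    (hc : HasCompactSupport u) (hs : tsupport u ⊆ Ω) :
    ∃ L : ℝ, ∀ ε > 0, ∃ δ > 0, ∀ ρ : E D → ℝ, IsRadialDensity ρ → ∀ x y : E D,
      ‖Ω.indicator (nonlocalIntegrand ρ u x) y
        - (inner ℝ (gradient u x) (‖x - y‖⁻¹ • (x - y)) * ρ (x - y)) • (‖x - y‖⁻¹ • (x - y))‖
      ≤ ε * ρ (x - y) + L * {z : E D | δ < ‖z‖}.indicator ρ (x - y) := by
  obtain ⟨K, hK⟩ := hu.lipschitzWith_of_hasCompactSupport hc one_ne_zero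
  obtain ⟨δ₀, hδ₀, hthick⟩ := hc.isCompact.exists_thickening_subset_open hΩ hs
  -- One `K` bounds the difference quotient, the other the gradient.
  refine ⟨2 * K, fun ε hε => ?_⟩
  obtain ⟨δ₁, hδ₁, hlin⟩ := exists_forall_abs_sub_fderiv_le hu hc hε
  -- `δ₁` controls the linearisation; `δ₀ / 2` keeps points near the support inside `Ω`.
  refine ⟨min δ₁ (δ₀ / 2), by positivity, fun ρ hρ x y => ?_⟩
  set z := x - y with hz
  have hρz := hρ.nonneg z
  have hF : nonlocalIntegrand ρ u x y = ((u x - u y) / ‖z‖ * ρ z) • (‖z‖⁻¹ • z) := rfl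
  have hfd : ‖fderiv ℝ u x‖ ≤ K := norm_fderiv_le_of_lipschitz ℝ hK
  have hin : |inner ℝ (gradient u x) (‖z‖⁻¹ • z)| ≤ K :=
    (IsRadialDensity.abs_inner_inv_norm_smul_le _ _).trans (by rwa [norm_gradient])
  have hquot : |(u x - u y) / ‖z‖| ≤ K := by
    rw [abs_div, abs_norm]
    refine div_le_of_le_mul₀ (norm_nonneg _) K.2 ?_
    simpa [dist_eq_norm] using hK.dist_le_mul x y
  -- both terms are multiples of the same vector
  obtain ⟨c, hcF, hcK, hcl⟩ : ∃ c : ℝ, Ω.indicator (nonlocalIntegrand ρ u x) y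
      = (c / ‖z‖ * ρ z) • (‖z‖⁻¹ • z) ∧ |c / ‖z‖| ≤ K ∧
      (‖z‖ ≤ min δ₁ (δ₀ / 2) → c = u x - u y) := by
    by_cases hy : y ∈ Ω
    · exact ⟨u x - u y, by rw [indicator_of_mem hy, hF], hquot, fun _ => rfl⟩
    -- If `y` is outside `Ω` and `z` is short, `x` is outside the support too, so cutting the
    -- integrand off at `Ω` loses nothing.
    · refine ⟨0, by rw [indicator_of_notMem hy]; simp, by simp, fun hzδ => ?_⟩
      have hy0 : u y = 0 := image_eq_zero_of_notMem_tsupport fun h => hy (hs h)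
      have hx0 : u x = 0 := by
        refine image_eq_zero_of_notMem_tsupport fun h => hy (hthick ?_)
        rw [mem_thickening_iff]
        refine ⟨x, h, ?_⟩
        rw [dist_comm, dist_eq_norm, ← hz]
        have := hzδ.trans (min_le_right _ _)
        linarith
      rw [hx0, hy0, sub_zero]
  rw [hcF, ← sub_smul, ← sub_mul, norm_smul, norm_mul, Real.norm_of_nonneg hρz]
  refine (mul_le_of_le_one_right (by positivity)
    (IsRadialDensity.norm_inv_norm_smul_le _)).trans ?_
  by_cases hzδ : ‖z‖ ≤ min δ₁ (δ₀ / 2)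
  · rw [indicator_of_notMem (by simpa using hzδ), mul_zero, add_zero]
    gcongr
    rw [hcl hzδ, real_inner_smul_right, inner_gradient, ← div_eq_inv_mul, ← sub_div, norm_div,
      norm_norm]
    exact div_le_of_le_mul₀ (norm_nonneg _) hε.le (hlin x y (hzδ.trans (min_le_left _ _)))
  · rw [indicator_of_mem (show z ∈ {z : E D | min δ₁ (δ₀ / 2) < ‖z‖} from not_le.1 hzδ)]
    have : ‖c / ‖z‖ - inner ℝ (gradient u x) (‖z‖⁻¹ • z)‖ ≤ 2 * K := by
      refine (norm_sub_le _ _).trans ?_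
      rw [Real.norm_eq_abs, Real.norm_eq_abs]
      linarith
    nlinarith [mul_le_mul_of_nonneg_right this hρz, mul_nonneg hε.le hρz]

/-- Writing the gradient as `D` times the moment integral turns the error into a single integral, to
which the pointwise comparison applies. -/
lemma tendstoUniformlyOn_nonlocalGradient (hD : 0 < D) (hΩ : IsOpen Ω) {ρ : ℕ → E D → ℝ}
    (hρ : IsKernelSequence ρ) (hu : ContDiff ℝ 1 u) (hc : HasCompactSupport u)
    (hs : tsupport u ⊆ Ω) :
    TendstoUniformlyOn (fun n => nonlocalGradient (ρ n) Ω u) (gradient u) atTop univ := by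
  obtain ⟨L, hL⟩ := exists_forall_norm_indicator_sub_le hΩ hu hc hs
  rw [Metric.tendstoUniformlyOn_iff]
  intro η hη
  have hD' : (0 : ℝ) < D := by exact_mod_cast hD
  -- After multiplication by `D` and integration against mass one this contributes `η / 2`; the tail
  -- contributes the other half.
  obtain ⟨δ, hδ, hest⟩ := hL (η / (2 * D)) (by positivity)
  have htail : Tendsto (fun n => (D : ℝ) * (L * ∫ x in {x : E D | δ < ‖x‖}, ρ n x)) atTop
      (𝓝 0) := by
    simpa using ((hρ.tail δ hδ).const_mul L).const_mul (D : ℝ)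
  filter_upwards [htail.eventually_lt_const (half_pos hη)] with n hn x _
  have hρn := hρ.density n
  have hmeas : MeasurableSet {z : E D | δ < ‖z‖} := measurableSet_lt (by fun_prop) (by fun_prop)
  have hint := integrable_nonlocalIntegrand_of_contDiff hρn hu hc x
  have hi1 : Integrable fun y => η / (2 * D) * ρ n (x - y) :=
    (hρn.integrable_comp_sub_left x).const_mul _
  have hi2 : Integrable fun y => L * {z : E D | δ < ‖z‖}.indicator (ρ n) (x - y) :=
    ((hρn.integrable.indicator hmeas).comp_sub_left x).const_mul _
  set m : E D → E D := fun z => (inner ℝ (gradient u x) (‖z‖⁻¹ • z) * ρ n z) • (‖z‖⁻¹ • z)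
  have hmi : Integrable fun y => m (x - y) :=
    (hρn.integrable_moment (gradient u x)).comp_sub_left x
  have hmom : (D : ℝ) • ∫ z, m z = gradient u x := hρn.integral_moment hD _
  rw [nonlocalGradient_eq_integral hint.integrableOn, dist_comm, dist_eq_norm,
    ← integral_indicator hΩ.measurableSet]
  rw [← hmom, ← smul_sub, ← integral_sub_left_eq_self m volume x,
    ← integral_sub (hint.indicator hΩ.measurableSet) hmi, norm_smul, Real.norm_natCast]
  have h := norm_integral_le_of_norm_le (hi1.add hi2) (.of_forall fun y => hest (ρ n) hρn x y)
  simp only [Pi.add_apply] at h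
  rw [integral_add hi1 hi2, integral_const_mul, integral_const_mul,
    integral_sub_left_eq_self (ρ n), hρn.integral_eq_one,
    integral_sub_left_eq_self ({z : E D | δ < ‖z‖}.indicator (ρ n)),
    integral_indicator hmeas] at h
  calc _ ≤ D * (η / (2 * D) * 1 + L * ∫ x in {x : E D | δ < ‖x‖}, ρ n x) := by gcongr
    _ = η / 2 + D * (L * ∫ x in {x : E D | δ < ‖x‖}, ρ n x) := by field_simp
    _ < η := by linarith

/-! ### Affine approximants -/

lemma norm_inner_sub_le {R : ℝ} (hR : ∀ x ∈ Ω, ‖x‖ ≤ R) {G H : E D → E D} {x₀ x : E D}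
    (hx₀ : x₀ ∈ Ω) (hx : x ∈ Ω) :
    ‖inner ℝ (x - x₀) (G x₀) - inner ℝ (x - x₀) (H x₀)‖ ≤ 2 * R * ‖G x₀ - H x₀‖ := by
  rw [← inner_sub_right]
  refine (norm_inner_le_norm _ _).trans ?_
  gcongr
  linarith [norm_sub_le x x₀, hR x hx, hR x₀ hx₀]

lemma tendstoUniformlyOn_affineApprox (hΩb : Bornology.IsBounded Ω) (u : E D → ℝ)
    {F : ℕ → E D → E D} {G : E D → E D} (h : TendstoUniformlyOn F G atTop Ω) :
    TendstoUniformlyOn (fun n (p : E D × E D) => affineApprox u (F n) p.1 p.2)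
      (fun p => affineApprox u G p.1 p.2) atTop (Ω ×ˢ Ω) := by
  obtain ⟨R, hR0, hR⟩ := hΩb.exists_pos_norm_le
  rw [Metric.tendstoUniformlyOn_iff] at h ⊢
  intro ε hε
  filter_upwards [h (ε / (2 * R)) (by positivity)] with n hn p hp
  have h1 := hn p.1 hp.1
  rw [dist_eq_norm] at h1 ⊢
  rw [affineApprox, affineApprox, add_sub_add_left_eq_sub]
  calc _ ≤ 2 * R * ‖G p.1 - F n p.1‖ := norm_inner_sub_le hR hp.1 hp.2
    _ < 2 * R * (ε / (2 * R)) := by gcongr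
    _ = ε := by field_simp

lemma tendstoUniformlyOn_remainder (hΩb : Bornology.IsBounded Ω) (u : E D → ℝ)
    {F : ℕ → E D → E D} {G : E D → E D} (h : TendstoUniformlyOn F G atTop Ω) :
    TendstoUniformlyOn (fun n (p : E D × E D) => remainder u (F n) p.1 p.2)
      (fun p => remainder u G p.1 p.2) atTop (Ω ×ˢ Ω) := by
  have := tendstoUniformlyOn_affineApprox hΩb u h
  rw [Metric.tendstoUniformlyOn_iff] at this ⊢
  simpa only [remainder, dist_sub_left] using this

/-! ### Zero extension and nonlocal gradients of `C¹_c(Ω)` functions -/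

namespace MemC1c

/-- `Ω` and the complement of `K` are open and cover the space; the extension is `u` on the first
and zero on the second. -/
lemma exists_extension (hΩ : IsOpen Ω) (hu : MemC1c Ω u) :
    ContDiff ℝ 1 (Ω.indicator u) ∧ HasCompactSupport (Ω.indicator u) ∧
      tsupport (Ω.indicator u) ⊆ Ω := by
  obtain ⟨hdiff, K, hK, hKΩ, hu0⟩ := hu
  have hzero : ∀ x ∉ K, Ω.indicator u x = 0 := fun x hx => by
    by_cases hxΩ : x ∈ Ω
    · rw [indicator_of_mem hxΩ, hu0 x ⟨hxΩ, hx⟩]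
    · exact indicator_of_notMem hxΩ _
  have hts : tsupport (Ω.indicator u) ⊆ K :=
    closure_minimal (fun x hx => by_contra fun hxK => hx (hzero x hxK)) hK.isClosed
  refine ⟨contDiff_iff_contDiffAt.2 fun x => ?_, HasCompactSupport.intro hK hzero,
    hts.trans hKΩ⟩
  by_cases hx : x ∈ Ω
  · refine (hdiff.contDiffAt (hΩ.mem_nhds hx)).congr_of_eventuallyEq ?_
    filter_upwards [hΩ.mem_nhds hx] with y hy using indicator_of_mem hy _
  · refine contDiffAt_const (c := (0 : ℝ)) |>.congr_of_eventuallyEq ?_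
    filter_upwards [hK.isClosed.isOpen_compl.mem_nhds fun h => hx (hKΩ h)] with y hy
      using hzero y hy

lemma integrableOn_nonlocalIntegrand (hΩ : IsOpen Ω) (hu : MemC1c Ω u) (hρ : IsRadialDensity ρ)
    (hx : x ∈ Ω) : IntegrableOn (nonlocalIntegrand ρ u x) Ω := by
  obtain ⟨h1, h2, -⟩ := hu.exists_extension hΩ
  refine (integrable_nonlocalIntegrand_of_contDiff hρ h1 h2 x).integrableOn.congr_fun
    (nonlocalIntegrand_congr (fun y hy => indicator_of_mem hy u) hx) hΩ.measurableSet

lemma tendstoUniformlyOn_nonlocalGradient (hD : 0 < D) (hΩ : IsOpen Ω) {ρ : ℕ → E D → ℝ}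
    (hρ : IsKernelSequence ρ) (hu : MemC1c Ω u) :
    TendstoUniformlyOn (fun n => nonlocalGradient (ρ n) Ω u) (gradient u) atTop Ω := by
  obtain ⟨h1, h2, h3⟩ := hu.exists_extension hΩ
  have heq : EqOn (Ω.indicator u) u Ω := fun y hy => indicator_of_mem hy u
  refine (((NonlocalTaylor.tendstoUniformlyOn_nonlocalGradient hD hΩ hρ h1 h2 h3).mono
    (subset_univ Ω)).congr (.of_forall fun n x hx => ?_)).congr_right fun x hx => ?_
  · rw [nonlocalGradient_eq_integral
        (integrable_nonlocalIntegrand_of_contDiff (hρ.density n) h1 h2 x).integrableOn,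
      nonlocalGradient_eq_integral
        (hu.integrableOn_nonlocalIntegrand hΩ (hρ.density n) hx),
      setIntegral_congr_fun hΩ.measurableSet (nonlocalIntegrand_congr heq hx)]
  · exact (heq.eventuallyEq_of_mem (hΩ.mem_nhds hx)).gradient_eq

end MemC1c

end NonlocalTaylor

namespace NonlocalTaylor

variable {D : ℕ} {ρ : E D → ℝ} {Ω : Set (E D)} {u v : E D → ℝ} {G : E D → E D} {x : E D}

/-! ### Square integrals -/

lemma eLpNorm_two_sq {α F : Type*} [MeasurableSpace α] {μ : Measure α} [ENorm F] (f : α → F) :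
    eLpNorm f 2 μ ^ 2 = ∫⁻ a, ‖f a‖ₑ ^ 2 ∂μ := by
  have := eLpNorm_nnreal_pow_eq_lintegral (μ := μ) (f := f) (p := 2) two_ne_zero
  simpa only [NNReal.coe_ofNat, ENNReal.coe_ofNat, ENNReal.rpow_two] using this

lemma eLpNorm_two_le_of_lintegral_sq_le {α F : Type*} [MeasurableSpace α] {μ : Measure α} [ENorm F]
    {f : α → F} {C : ENNReal} (h : ∫⁻ a, ‖f a‖ₑ ^ 2 ∂μ ≤ C ^ 2) : eLpNorm f 2 μ ≤ C := by
  rw [← eLpNorm_two_sq] at h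
  exact (ENNReal.pow_le_pow_left_iff two_ne_zero).1 h

/-- Jensen's inequality for the square. -/
lemma sq_lintegral_le {α : Type*} [MeasurableSpace α] {μ : Measure α} [IsProbabilityMeasure μ]
    {f : α → ENNReal} (hf : AEMeasurable f μ) : (∫⁻ a, f a ∂μ) ^ 2 ≤ ∫⁻ a, f a ^ 2 ∂μ := by
  have h := eLpNorm_le_eLpNorm_of_exponent_le (p := 1) (q := 2) one_le_two
    hf.aestronglyMeasurable
  have h2 := eLpNorm_two_sq (μ := μ) f
  simp only [enorm_eq_self] at h2
  rw [eLpNorm_one_eq_lintegral_enorm] at h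
  simp only [enorm_eq_self] at h
  rw [← h2]
  gcongr

/-! ### Translations of `H¹` functions -/

/-- Fundamental theorem of calculus on the segment from `x` to `x - z`, then Jensen in `t` and
Cauchy–Schwarz. -/
lemma enorm_sub_comp_sub_sq_le (hu : ContDiff ℝ 1 u) (x z : E D) :
    ‖u x - u (x - z)‖ₑ ^ 2
      ≤ ∫⁻ t in Ioc (0 : ℝ) 1, ‖z‖ₑ ^ 2 * ‖gradient u (x - t • z)‖ₑ ^ 2 := by
  have hcont : Continuous fun t : ℝ => fderiv ℝ u (x - t • z) z :=
    ((hu.continuous_fderiv one_ne_zero).comp (by fun_prop)).clm_apply continuous_const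
  have hderiv (t : ℝ) :
      HasDerivAt (fun t : ℝ => - u (x - t • z)) (fderiv ℝ u (x - t • z) z) t := by
    have h1 : HasDerivAt (fun t : ℝ => x - t • z) (-z) t := by
      simpa using ((hasDerivAt_id t).smul_const z).const_sub x
    exact (((hu.differentiable one_ne_zero) _).hasFDerivAt.comp_hasDerivAt t h1).neg.congr_deriv
      (by simp)
  have hint : ∫ t in (0 : ℝ)..1, fderiv ℝ u (x - t • z) z = u x - u (x - z) := by
    rw [intervalIntegral.integral_eq_sub_of_hasDerivAt (fun t _ => hderiv t)
      (hcont.intervalIntegrable _ _)]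
    simp
    ring
  have : IsProbabilityMeasure (volume.restrict (Ioc (0 : ℝ) 1)) := ⟨by simp⟩
  rw [← hint, intervalIntegral.integral_of_le zero_le_one]
  calc _ ≤ (∫⁻ t in Ioc (0 : ℝ) 1, ‖fderiv ℝ u (x - t • z) z‖ₑ) ^ 2 := by
        gcongr
        exact enorm_integral_le_lintegral_enorm _
    _ ≤ ∫⁻ t in Ioc (0 : ℝ) 1, ‖fderiv ℝ u (x - t • z) z‖ₑ ^ 2 :=
        sq_lintegral_le hcont.enorm.measurable.aemeasurable
    _ ≤ _ := by
        refine lintegral_mono fun t => ?_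
        rw [← mul_pow, mul_comm]
        gcongr
        rw [← inner_gradient, ← ofReal_norm, ← ofReal_norm, ← ofReal_norm,
          ← ENNReal.ofReal_mul (norm_nonneg _)]
        exact ENNReal.ofReal_le_ofReal (norm_inner_le_norm _ _)

lemma continuous_gradient (hu : ContDiff ℝ 1 u) : Continuous (gradient u) :=
  (LinearIsometryEquiv.continuous _).comp (hu.continuous_fderiv one_ne_zero)

/-- Integrate the pointwise bound in `x` and exchange integrals; translation invariance removes the
dependence on `t`. -/
lemma eLpNorm_sub_comp_sub_le_of_contDiff (hu : ContDiff ℝ 1 u) (z : E D) :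
    eLpNorm (fun x => u x - u (x - z)) 2 ≤ ‖z‖ₑ * eLpNorm (gradient u) 2 := by
  refine eLpNorm_two_le_of_lintegral_sq_le ?_
  rw [mul_pow, eLpNorm_two_sq]
  have hmeas : Measurable fun p : E D × ℝ => ‖z‖ₑ ^ 2 * ‖gradient u (p.1 - p.2 • z)‖ₑ ^ 2 := by
    have : Continuous fun p : E D × ℝ => gradient u (p.1 - p.2 • z) :=
      (continuous_gradient hu).comp (by fun_prop)
    exact (this.enorm.measurable.pow_const 2).const_mul _
  calc _ ≤ ∫⁻ x, ∫⁻ t in Ioc (0 : ℝ) 1, ‖z‖ₑ ^ 2 * ‖gradient u (x - t • z)‖ₑ ^ 2 :=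
        lintegral_mono fun x => enorm_sub_comp_sub_sq_le hu x z
    _ = ∫⁻ t in Ioc (0 : ℝ) 1, ∫⁻ x, ‖z‖ₑ ^ 2 * ‖gradient u (x - t • z)‖ₑ ^ 2 :=
        lintegral_lintegral_swap hmeas.aemeasurable
    _ = ∫⁻ t in Ioc (0 : ℝ) 1, ‖z‖ₑ ^ 2 * ∫⁻ x, ‖gradient u x‖ₑ ^ 2 := by
        congr 1 with t
        rw [lintegral_sub_right_eq_self (fun x => ‖z‖ₑ ^ 2 * ‖gradient u x‖ₑ ^ 2),
          lintegral_const_mul _ ((continuous_gradient hu).enorm.measurable.pow_const 2)]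
    _ = _ := by simp

/-- `u` and `G` are the limits in `L²(Ω)` of a sequence of test functions and of their
gradients. -/
structure IsTestLimit (Ω : Set (E D)) (u : E D → ℝ) (G : E D → E D) : Prop where
  memLp : MemLp u 2 (volume.restrict Ω)
  memLp_gradient : MemLp G 2 (volume.restrict Ω)
  exists_seq : ∃ φ : ℕ → E D → ℝ, (∀ k, IsTestFunction Ω (φ k)) ∧
    Tendsto (fun k => eLpNorm (fun x => φ k x - u x) 2 (volume.restrict Ω)) atTop (𝓝 0) ∧
    Tendsto (fun k => eLpNorm (fun x => gradient (φ k) x - G x) 2 (volume.restrict Ω))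
      atTop (𝓝 0)

/-! ### Test functions and their gradients -/

namespace IsTestFunction

lemma contDiff_one (hu : IsTestFunction Ω u) : ContDiff ℝ 1 u :=
  hu.1.of_le (by exact_mod_cast le_top)

lemma memC1c (hu : IsTestFunction Ω u) : MemC1c Ω u :=
  ⟨hu.contDiff_one.contDiffOn, tsupport u, hu.2.1.isCompact, hu.2.2,
    fun _ hx => image_eq_zero_of_notMem_tsupport hx.2⟩

lemma sub (hu : IsTestFunction Ω u) (hv : IsTestFunction Ω v) :
    IsTestFunction Ω (fun x => u x - v x) := by
  refine ⟨hu.1.sub hv.1, hu.2.1.sub hv.2.1, ?_⟩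
  exact (tsupport_sub u v).trans (union_subset hu.2.2 hv.2.2)

lemma gradient_sub (hu : IsTestFunction Ω u) (hv : IsTestFunction Ω v) (x : E D) :
    gradient (fun x => u x - v x) x = gradient u x - gradient v x := by
  rw [gradient, fderiv_fun_sub (hu.contDiff_one.differentiable one_ne_zero x)
    (hv.contDiff_one.differentiable one_ne_zero x), map_sub]
  rfl

lemma indicator_eq (hu : IsTestFunction Ω u) : Ω.indicator u = u :=
  indicator_eq_self.2 ((subset_tsupport u).trans hu.2.2)

lemma gradient_eq_zero (hu : IsTestFunction Ω u) (hx : x ∉ Ω) : gradient u x = 0 := by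
  rw [← norm_eq_zero, norm_gradient, norm_eq_zero]
  exact image_eq_zero_of_notMem_tsupport fun h => hx (hu.2.2 (tsupport_fderiv_subset ℝ h))

lemma indicator_gradient_eq (hu : IsTestFunction Ω u) : Ω.indicator (gradient u) = gradient u :=
  indicator_eq_self.2 fun _ hx => by_contra fun h => hx (hu.gradient_eq_zero h)

lemma memLp (hu : IsTestFunction Ω u) : MemLp u 2 (volume.restrict Ω) :=
  (hu.1.continuous.memLp_of_hasCompactSupport hu.2.1).restrict _

lemma memLp_gradient (hu : IsTestFunction Ω u) : MemLp (gradient u) 2 (volume.restrict Ω) := by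
  refine ((continuous_gradient hu.contDiff_one).memLp_of_hasCompactSupport ?_).restrict _
  refine HasCompactSupport.of_support_subset_isCompact hu.2.1.isCompact fun x hx => ?_
  refine tsupport_fderiv_subset ℝ (subset_tsupport _ ?_)
  rw [Function.mem_support, ← norm_ne_zero_iff] at hx ⊢
  rwa [← norm_gradient]

lemma eLpNorm_gradient (hu : IsTestFunction Ω u) (hΩ : MeasurableSet Ω) :
    eLpNorm (gradient u) 2 = eLpNorm (gradient u) 2 (volume.restrict Ω) := by
  rw [← eLpNorm_indicator_eq_eLpNorm_restrict hΩ, hu.indicator_gradient_eq]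

end IsTestFunction

namespace IsTestLimit

lemma sub_testFunction (h : IsTestLimit Ω u G) (hv : IsTestFunction Ω v) :
    IsTestLimit Ω (fun x => u x - v x) (fun x => G x - gradient v x) := by
  obtain ⟨hu, hG, φ, hφ, h1, h2⟩ := h
  refine ⟨hu.sub hv.memLp, hG.sub hv.memLp_gradient, fun k x => φ k x - v x,
    fun k => (hφ k).sub hv, ?_, ?_⟩
  · simpa only [sub_sub_sub_cancel_right] using h1
  · simpa only [(hφ _).gradient_sub hv, sub_sub_sub_cancel_right] using h2

/-- The estimate passes to the limit along test functions. Zero boundary values matter here: they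
make the zero extension an `L²` limit of smooth functions on the whole space, with no jump across
the boundary. -/
lemma eLpNorm_sub_comp_sub_le (hΩ : MeasurableSet Ω) (h : IsTestLimit Ω u G) (z : E D) :
    eLpNorm (fun x => Ω.indicator u x - Ω.indicator u (x - z)) 2
      ≤ ‖z‖ₑ * eLpNorm G 2 (volume.restrict Ω) := by
  obtain ⟨hu, hG, φ, hφ, h1, h2⟩ := h
  set U := Ω.indicator u
  have hU : AEStronglyMeasurable U := (aestronglyMeasurable_indicator_iff hΩ).2 hu.1
  have hφm (k : ℕ) : AEStronglyMeasurable (φ k) := (hφ k).1.continuous.aestronglyMeasurable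
  have hz := measurePreserving_sub_right (volume : Measure (E D)) z
  have hn (k : ℕ) : eLpNorm (φ k - U) 2 = eLpNorm (fun x => φ k x - u x) 2 (volume.restrict Ω) := by
    rw [← eLpNorm_indicator_eq_eLpNorm_restrict hΩ]
    congr 1
    rw [← (hφ k).indicator_eq, ← indicator_sub']
    rw [(hφ k).indicator_eq]
    rfl
  have hg (k : ℕ) : eLpNorm (gradient (φ k)) 2
      ≤ eLpNorm (fun x => gradient (φ k) x - G x) 2 (volume.restrict Ω)
        + eLpNorm G 2 (volume.restrict Ω) := by
    rw [(hφ k).eLpNorm_gradient hΩ]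
    refine le_trans (le_of_eq ?_)
      (eLpNorm_add_le ((hφ k).memLp_gradient.1.sub hG.1) hG.1 one_le_two)
    congr 1
    exact (sub_add_cancel (gradient (φ k)) G).symm
  have hbound (k : ℕ) : eLpNorm (fun x => U x - U (x - z)) 2
      ≤ eLpNorm (fun x => φ k x - u x) 2 (volume.restrict Ω)
        + ‖z‖ₑ * (eLpNorm (fun x => gradient (φ k) x - G x) 2 (volume.restrict Ω)
        + eLpNorm G 2 (volume.restrict Ω))
        + eLpNorm (fun x => φ k x - u x) 2 (volume.restrict Ω) := by
    have hdm : AEStronglyMeasurable (fun x => φ k x - φ k (x - z)) :=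
      (hφm k).sub ((hφm k).comp_measurePreserving hz)
    have hcm : AEStronglyMeasurable ((φ k - U) ∘ fun x => x - z) :=
      ((hφm k).sub hU).comp_measurePreserving hz
    have hsplit : (fun x => U x - U (x - z))
        = ((fun x => φ k x - φ k (x - z)) - (φ k - U)) + (φ k - U) ∘ fun x => x - z := by
      ext y
      simp
    calc _ ≤ eLpNorm ((fun x => φ k x - φ k (x - z)) - (φ k - U)) 2
          + eLpNorm ((φ k - U) ∘ fun x => x - z) 2 := by
          rw [hsplit]
          exact eLpNorm_add_le (hdm.sub ((hφm k).sub hU)) hcm one_le_two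
      _ ≤ eLpNorm (fun x => φ k x - φ k (x - z)) 2 + eLpNorm (φ k - U) 2
          + eLpNorm (φ k - U) 2 := by
          rw [eLpNorm_comp_measurePreserving ((hφm k).sub hU) hz]
          gcongr
          exact eLpNorm_sub_le hdm ((hφm k).sub hU) one_le_two
      _ ≤ ‖z‖ₑ * eLpNorm (gradient (φ k)) 2 + eLpNorm (φ k - U) 2 + eLpNorm (φ k - U) 2 := by
          gcongr
          exact eLpNorm_sub_comp_sub_le_of_contDiff (hφ k).contDiff_one z
      _ ≤ _ := by
          rw [hn, add_comm (‖z‖ₑ * _)]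
          gcongr
          exact hg k
  have h3 := (h1.add (ENNReal.Tendsto.const_mul (h2.add_const (eLpNorm G 2 (volume.restrict Ω)))
    (Or.inr (enorm_ne_top (x := z))))).add h1
  simpa using ge_of_tendsto' h3 hbound

end IsTestLimit

/-! ### The nonlocal gradient of `H¹₀` functions -/

lemma aestronglyMeasurable_uncurry_nonlocalIntegrand (hρ : IsRadialDensity ρ)
    (hu : AEStronglyMeasurable u) :
    AEStronglyMeasurable (fun p : E D × E D => nonlocalIntegrand ρ u p.1 p.2)
      (volume.prod volume) := by
  have h1 : AEStronglyMeasurable (fun p : E D × E D => ρ (p.1 - p.2)) (volume.prod volume) :=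
    hρ.integrable.aestronglyMeasurable.comp_quasiMeasurePreserving
      (quasiMeasurePreserving_sub volume volume)
  have h2 : AEStronglyMeasurable (fun p : E D × E D => ‖p.1 - p.2‖⁻¹) (volume.prod volume) :=
    Measurable.aestronglyMeasurable (by fun_prop)
  have h3 : AEStronglyMeasurable (fun p : E D × E D => p.1 - p.2) (volume.prod volume) :=
    Measurable.aestronglyMeasurable (by fun_prop)
  unfold nonlocalIntegrand
  simp_rw [div_eq_mul_inv]
  exact (((hu.comp_fst.sub hu.comp_snd).mul h2).mul h1).smul (h2.smul h3)

/-- A function with difference quotients bounded in `L²` has nonlocal gradients bounded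
in `L²`, with the same bound. -/
lemma lintegral_sq_lintegral_nonlocalIntegrand_le (hρ : IsRadialDensity ρ)
    (hu : AEStronglyMeasurable u) {C : ENNReal}
    (h : ∀ z, eLpNorm (fun x => u x - u (x - z)) 2 ≤ ‖z‖ₑ * C) :
    ∫⁻ x, (∫⁻ y, ‖nonlocalIntegrand ρ u x y‖ₑ) ^ 2 ≤ C ^ 2 := by
  -- `ρ` is absorbed into a probability measure, so that Jensen applies to the difference quotients.
  set μ : Measure (E D) := volume.withDensity fun z => ENNReal.ofReal (ρ z) with hμ
  have hρm : AEMeasurable (fun z => ENNReal.ofReal (ρ z)) :=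
    hρ.integrable.aestronglyMeasurable.aemeasurable.ennreal_ofReal
  have hprob : IsProbabilityMeasure μ := ⟨by
    rw [hμ, withDensity_apply _ MeasurableSet.univ, Measure.restrict_univ, hρ.lintegral_ofReal]⟩
  have hac : μ ≪ volume := withDensity_absolutelyContinuous _ _
  set a : E D → E D → ENNReal := fun x z => ‖u x - u (x - z)‖ₑ * ‖‖z‖⁻¹‖ₑ with ha
  have hinv : Measurable fun z : E D => ‖‖z‖⁻¹‖ₑ := by fun_prop
  have ham (x : E D) : AEMeasurable (a x) :=
    (aestronglyMeasurable_const.sub (hu.comp_quasiMeasurePreserving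
      (quasiMeasurePreserving_sub_left_of_right_invariant volume x))).enorm.mul hinv.aemeasurable
  have hdiff : AEMeasurable (fun p : E D × E D => ‖u p.1 - u (p.1 - p.2)‖ₑ ^ 2)
      (volume.prod volume) :=
    (hu.comp_fst.sub (hu.comp_quasiMeasurePreserving
      (quasiMeasurePreserving_sub volume volume))).enorm.pow_const 2
  have huncurry : AEMeasurable (Function.uncurry fun x z => a x z ^ 2) (volume.prod μ) := by
    refine AEMeasurable.mono_ac (ν := volume.prod volume) ?_
      (Measure.AbsolutelyContinuous.rfl.prod hac)
    simp only [Function.uncurry_def, ha, mul_pow]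
    exact hdiff.mul ((hinv.comp measurable_snd).pow_const 2).aemeasurable
  have hinner (x : E D) : ∫⁻ y, ‖nonlocalIntegrand ρ u x y‖ₑ ≤ ∫⁻ z, a x z ∂μ := by
    rw [hμ, lintegral_withDensity_eq_lintegral_mul₀ hρm (ham x),
      ← lintegral_sub_left_eq_self ((fun z => ENNReal.ofReal (ρ z)) * a x) x]
    refine lintegral_mono fun y => ?_
    simp only [Pi.mul_apply, ha, sub_sub_cancel]
    rw [← ofReal_norm, ← ofReal_norm, ← ofReal_norm, ← ENNReal.ofReal_mul (norm_nonneg _),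
      ← ENNReal.ofReal_mul (hρ.nonneg _), norm_inv, norm_norm, ← div_eq_mul_inv, mul_comm]
    exact ENNReal.ofReal_le_ofReal (norm_nonlocalIntegrand_le hρ x y)
  calc _ ≤ ∫⁻ x, ∫⁻ z, a x z ^ 2 ∂μ := by
        refine lintegral_mono fun x => ?_
        refine le_trans ?_ (sq_lintegral_le ((ham x).mono_ac hac))
        exact pow_le_pow_left' (hinner x) 2
    _ = ∫⁻ z, (∫⁻ x, a x z ^ 2) ∂μ := lintegral_lintegral_swap huncurry
    _ ≤ ∫⁻ _, C ^ 2 ∂μ := by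
        refine lintegral_mono fun z => ?_
        simp only [ha, mul_pow]
        rw [lintegral_mul_const' _ _ (by finiteness), ← eLpNorm_two_sq, ← mul_pow]
        gcongr
        calc _ ≤ ‖z‖ₑ * C * ‖‖z‖⁻¹‖ₑ := by gcongr; exact h z
          _ = ‖‖z‖⁻¹ * ‖z‖‖ₑ * C := by rw [enorm_mul, enorm_norm]; ring
          -- Only an inequality, because `‖z‖⁻¹ * ‖z‖` is `0` at the origin.
          _ ≤ 1 * C := by
            gcongr
            rw [← ofReal_norm, ← ENNReal.ofReal_one]
            refine ENNReal.ofReal_le_ofReal ?_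
            rw [Real.norm_of_nonneg (by positivity)]
            exact inv_mul_le_one
          _ = C := one_mul C
    _ = C ^ 2 := by simp

namespace IsTestLimit

lemma aestronglyMeasurable_indicator (hΩ : MeasurableSet Ω) (h : IsTestLimit Ω u G) :
    AEStronglyMeasurable (Ω.indicator u) :=
  (aestronglyMeasurable_indicator_iff hΩ).2 h.memLp.1

lemma lintegral_sq_le (hΩ : MeasurableSet Ω) (h : IsTestLimit Ω u G) (hρ : IsRadialDensity ρ) :
    ∫⁻ x, (∫⁻ y, ‖nonlocalIntegrand ρ (Ω.indicator u) x y‖ₑ) ^ 2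
      ≤ eLpNorm G 2 (volume.restrict Ω) ^ 2 :=
  lintegral_sq_lintegral_nonlocalIntegrand_le hρ (h.aestronglyMeasurable_indicator hΩ)
    (h.eLpNorm_sub_comp_sub_le hΩ)

/-- A function of `x` with finite integral is finite almost everywhere; here it is the squared
integral of the norm of the integrand. -/
lemma ae_integrableOn (hΩ : MeasurableSet Ω) (h : IsTestLimit Ω u G) (hρ : IsRadialDensity ρ) :
    ∀ᵐ x ∂(volume.restrict Ω), IntegrableOn (nonlocalIntegrand ρ u x) Ω := by
  have hU := h.aestronglyMeasurable_indicator hΩ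
  have hmeas : AEMeasurable fun x => (∫⁻ y, ‖nonlocalIntegrand ρ (Ω.indicator u) x y‖ₑ) ^ 2 :=
    ((aestronglyMeasurable_uncurry_nonlocalIntegrand hρ hU).enorm.lintegral_prod_right').pow_const 2
  have hfin : eLpNorm G 2 (volume.restrict Ω) ^ 2 ≠ ⊤ :=
    ENNReal.pow_ne_top h.memLp_gradient.eLpNorm_ne_top
  have hlt := ae_lt_top' hmeas ((h.lintegral_sq_le hΩ hρ).trans_lt hfin.lt_top).ne
  filter_upwards [ae_restrict_of_ae hlt, ae_restrict_mem hΩ] with x hx hxΩ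
  have hint : IntegrableOn (nonlocalIntegrand ρ (Ω.indicator u) x) Ω :=
    ⟨aestronglyMeasurable_nonlocalIntegrand hρ hU.restrict x,
      (setLIntegral_le_lintegral _ _).trans_lt (by simpa using hx)⟩
  exact hint.congr_fun (nonlocalIntegrand_congr (fun y hy => indicator_of_mem hy u) hxΩ) hΩ

lemma aestronglyMeasurable_integral (hΩ : MeasurableSet Ω) (h : IsTestLimit Ω u G)
    (hρ : IsRadialDensity ρ) :
    AEStronglyMeasurable (fun x => ∫ y in Ω, nonlocalIntegrand ρ u x y) (volume.restrict Ω) := by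
  have hF := (aestronglyMeasurable_uncurry_nonlocalIntegrand hρ
    (h.aestronglyMeasurable_indicator hΩ)).mono_ac
      ((Measure.absolutelyContinuous_restrict (s := Ω)).prod
        (Measure.absolutelyContinuous_restrict (s := Ω)))
  refine hF.integral_prod_right'.congr ?_
  filter_upwards [ae_restrict_mem hΩ] with x hx
  exact setIntegral_congr_fun hΩ
    (nonlocalIntegrand_congr (fun y hy => indicator_of_mem hy u) hx)

lemma eLpNorm_integral_le (hΩ : MeasurableSet Ω) (h : IsTestLimit Ω u G)
    (hρ : IsRadialDensity ρ) :
    eLpNorm (fun x => ∫ y in Ω, nonlocalIntegrand ρ u x y) 2 (volume.restrict Ω)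
      ≤ eLpNorm G 2 (volume.restrict Ω) := by
  refine eLpNorm_two_le_of_lintegral_sq_le (le_trans ?_ (h.lintegral_sq_le hΩ hρ))
  refine (setLIntegral_mono' hΩ fun x hx => ?_).trans (setLIntegral_le_lintegral Ω _)
  gcongr
  rw [← setIntegral_congr_fun hΩ
    (nonlocalIntegrand_congr (ρ := ρ) (fun y hy => indicator_of_mem hy u) hx)]
  exact (enorm_integral_le_lintegral_enorm _).trans (setLIntegral_le_lintegral _ _)

lemma aestronglyMeasurable_nonlocalGradient (hΩ : MeasurableSet Ω) (h : IsTestLimit Ω u G)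
    (hρ : IsRadialDensity ρ) :
    AEStronglyMeasurable (nonlocalGradient ρ Ω u) (volume.restrict Ω) := by
  refine ((h.aestronglyMeasurable_integral hΩ hρ).const_smul (D : ℝ)).congr ?_
  filter_upwards [h.ae_integrableOn hΩ hρ] with x hx using (nonlocalGradient_eq_integral hx).symm

/-- The constant does not depend on `ρ`; this uniform stability drives the density argument. -/
lemma eLpNorm_nonlocalGradient_le (hΩ : MeasurableSet Ω) (h : IsTestLimit Ω u G)
    (hρ : IsRadialDensity ρ) :
    eLpNorm (nonlocalGradient ρ Ω u) 2 (volume.restrict Ω)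
      ≤ D * eLpNorm G 2 (volume.restrict Ω) := by
  have : nonlocalGradient ρ Ω u =ᵐ[volume.restrict Ω]
      (D : ℝ) • fun x => ∫ y in Ω, nonlocalIntegrand ρ u x y := by
    filter_upwards [h.ae_integrableOn hΩ hρ] with x hx using nonlocalGradient_eq_integral hx
  rw [eLpNorm_congr_ae this, eLpNorm_const_smul]
  gcongr
  · simp
  · exact h.eLpNorm_integral_le hΩ hρ

end IsTestLimit

end NonlocalTaylor

namespace NonlocalTaylor

variable {D : ℕ} {Ω : Set (E D)} {u v : E D → ℝ} {G H : E D → E D}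

/-! ### Weak gradients -/

lemma integrable_testFunction_smul (hv : IsTestFunction Ω v) (hG : LocallyIntegrableOn G Ω) :
    Integrable fun x => v x • G x := by
  have h : IntegrableOn (fun x => v x • G x) (tsupport v) :=
    (hG.integrableOn_compact_subset hv.2.2 hv.2.1.isCompact).continuousOn_smul
      hv.1.continuous.continuousOn hv.2.1.isCompact
  refine (integrableOn_iff_integrable_of_support_subset fun x hx => subset_tsupport v ?_).1 h
  exact fun h0 => hx (by simp [h0])

/-- The fundamental lemma of the calculus of variations, applied to `G - H`. -/
lemma IsWeakGradient.ae_eq (hΩ : IsOpen Ω) (hG : IsWeakGradient Ω u G)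
    (hH : IsWeakGradient Ω u H) : G =ᵐ[volume.restrict Ω] H := by
  have h := hΩ.ae_eq_zero_of_integral_contDiff_smul_eq_zero (hG.2.1.sub hH.2.1)
    fun g h1 h2 h3 => ?_
  · rw [Filter.EventuallyEq, ae_restrict_iff' hΩ.measurableSet]
    filter_upwards [h] with x hx hxΩ
    exact sub_eq_zero.1 (hx hxΩ)
  · have hg : IsTestFunction Ω g := ⟨h1, h2, h3⟩
    have hset (F : E D → E D) : ∫ x in Ω, g x • F x = ∫ x, g x • F x :=
      setIntegral_eq_integral_of_forall_compl_eq_zero fun x hx => by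
        rw [image_eq_zero_of_notMem_tsupport fun h => hx (h3 h), zero_smul]
    have heq := neg_injective ((hG.2.2 g hg).symm.trans (hH.2.2 g hg))
    rw [hset, hset] at heq
    simp only [Pi.sub_apply, smul_sub]
    rw [integral_sub (integrable_testFunction_smul hg hG.2.1)
      (integrable_testFunction_smul hg hH.2.1), heq, sub_self]

/-- Membership in `H¹₀` supplies its own weak gradient; uniqueness transfers its properties to the
given one. -/
lemma MemH10.isTestLimit (hΩ : IsOpen Ω) (hu : MemH10 Ω u) (hG : IsWeakGradient Ω u G) :
    IsTestLimit Ω u G := by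
  obtain ⟨hu, H, hH, hw, φ, hφ, h1, h2⟩ := hu
  have hHG := hw.ae_eq hΩ hG
  refine ⟨hu, hH.ae_eq hHG, φ, hφ, h1, h2.congr fun k => eLpNorm_congr_ae ?_⟩
  filter_upwards [hHG] with x hx
  rw [hx]

/-! ### Convergence in `L²` -/

lemma tendsto_eLpNorm_sub_of_tendstoUniformlyOn {F : ℕ → E D → E D} (hΩ : MeasurableSet Ω)
    (hfin : volume Ω ≠ ⊤) (h : TendstoUniformlyOn F G atTop Ω) :
    Tendsto (fun n => eLpNorm (fun x => F n x - G x) 2 (volume.restrict Ω)) atTop (𝓝 0) := by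
  rw [ENNReal.tendsto_nhds_zero]
  intro ε hε
  -- `η` is chosen so that `η` times the square root of the volume of `Ω` stays below `ε`.
  obtain ⟨η, hη, hlt⟩ := ENNReal.exists_nnreal_pos_mul_lt
    (ENNReal.rpow_ne_top_of_nonneg (y := (2 : ENNReal).toReal⁻¹) (by positivity) hfin) hε.ne'
  filter_upwards [Metric.tendstoUniformlyOn_iff.1 h η (by exact_mod_cast hη)] with n hn
  refine (eLpNorm_le_of_ae_bound (C := η) ?_).trans ?_
  · filter_upwards [ae_restrict_mem hΩ] with x hx
    rw [← dist_eq_norm, dist_comm]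
    exact (hn x hx).le
  · rw [Measure.restrict_apply_univ, mul_comm, ENNReal.ofReal_coe_nnreal]
    exact hlt.le

namespace IsTestLimit

/-- Insert `v`: the part from `u - v` costs `D` by stability, and replacing `G` by the gradient of
`v` costs `1`. -/
lemma eLpNorm_nonlocalGradient_sub_le (hΩ : MeasurableSet Ω) (h : IsTestLimit Ω u G)
    {ρ : E D → ℝ} (hρ : IsRadialDensity ρ) (hv : IsTestFunction Ω v) :
    eLpNorm (fun x => nonlocalGradient ρ Ω u x - G x) 2 (volume.restrict Ω)
      ≤ (D + 1) * eLpNorm (fun x => G x - gradient v x) 2 (volume.restrict Ω)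
        + eLpNorm (fun x => nonlocalGradient ρ Ω v x - gradient v x) 2 (volume.restrict Ω) := by
  have hw := h.sub_testFunction hv
  have hvl : IsTestLimit Ω v (gradient v) :=
    ⟨hv.memLp, hv.memLp_gradient, fun _ => v, fun _ => hv, by simp, by simp⟩
  set N := nonlocalGradient ρ Ω (fun x => u x - v x)
  have hN : AEStronglyMeasurable N (volume.restrict Ω) :=
    hw.aestronglyMeasurable_nonlocalGradient hΩ hρ
  have hvm : AEStronglyMeasurable (fun x => nonlocalGradient ρ Ω v x - gradient v x)
      (volume.restrict Ω) :=
    (hvl.aestronglyMeasurable_nonlocalGradient hΩ hρ).sub hv.memLp_gradient.1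
  have heq : (fun x => nonlocalGradient ρ Ω u x - G x) =ᵐ[volume.restrict Ω]
      (N - fun x => G x - gradient v x)
        + fun x => nonlocalGradient ρ Ω v x - gradient v x := by
    -- Linearity is used only where all three integrals converge absolutely, since `limUnder` takes
    -- an arbitrary value when no limit exists.
    filter_upwards [h.ae_integrableOn hΩ hρ, hvl.ae_integrableOn hΩ hρ,
      hw.ae_integrableOn hΩ hρ] with x h1 h2 h3
    simp only [N, Pi.add_apply, Pi.sub_apply]
    rw [nonlocalGradient_eq_integral h1, nonlocalGradient_eq_integral h2,
      nonlocalGradient_eq_integral h3]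
    simp_rw [nonlocalIntegrand_sub]
    rw [integral_sub h1 h2, smul_sub]
    abel
  rw [eLpNorm_congr_ae heq]
  refine (eLpNorm_add_le (hN.sub hw.memLp_gradient.1) hvm one_le_two).trans ?_
  gcongr
  refine (eLpNorm_sub_le hN hw.memLp_gradient.1 one_le_two).trans ?_
  rw [add_mul, one_mul]
  gcongr
  exact hw.eLpNorm_nonlocalGradient_le hΩ hρ

lemma tendsto_eLpNorm_nonlocalGradient_sub (hD : 0 < D) (hΩ : IsOpen Ω) (hfin : volume Ω ≠ ⊤)
    {ρ : ℕ → E D → ℝ} (hρ : IsKernelSequence ρ) (h : IsTestLimit Ω u G) :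
    Tendsto (fun n => eLpNorm (fun x => nonlocalGradient (ρ n) Ω u x - G x) 2
      (volume.restrict Ω)) atTop (𝓝 0) := by
  obtain ⟨φ, hφ, -, h2⟩ := h.exists_seq
  rw [ENNReal.tendsto_nhds_zero]
  intro ε hε
  have hε2 : 0 < ε / 2 := ENNReal.half_pos hε.ne'
  have h3 : Tendsto (fun k => (D + 1 : ENNReal)
      * eLpNorm (fun x => gradient (φ k) x - G x) 2 (volume.restrict Ω)) atTop (𝓝 0) := by
    simpa using ENNReal.Tendsto.const_mul h2 (Or.inr (by finiteness : (D + 1 : ENNReal) ≠ ⊤))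
  -- `k` is fixed before `n`, which is possible because the factor `D + 1` is independent of `n`.
  obtain ⟨k, hk⟩ := (ENNReal.tendsto_nhds_zero.1 h3 (ε / 2) hε2).exists
  have h4 := tendsto_eLpNorm_sub_of_tendstoUniformlyOn hΩ.measurableSet hfin
    ((hφ k).memC1c.tendstoUniformlyOn_nonlocalGradient hD hΩ hρ)
  filter_upwards [ENNReal.tendsto_nhds_zero.1 h4 (ε / 2) hε2] with n hn
  refine (h.eLpNorm_nonlocalGradient_sub_le hΩ.measurableSet (hρ.density n) (hφ k)).trans ?_
  rw [← ENNReal.add_halves ε]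
  refine add_le_add ?_ hn
  have hswap : eLpNorm (fun x => G x - gradient (φ k) x) 2 (volume.restrict Ω)
      = eLpNorm (fun x => gradient (φ k) x - G x) 2 (volume.restrict Ω) :=
    eLpNorm_sub_comm _ _ _ _
  rwa [hswap]

lemma memLp_nonlocalGradient_sub (hΩ : MeasurableSet Ω) (h : IsTestLimit Ω u G)
    {ρ : E D → ℝ} (hρ : IsRadialDensity ρ) :
    MemLp (fun x => nonlocalGradient ρ Ω u x - G x) 2 (volume.restrict Ω) := by
  refine MemLp.sub ⟨h.aestronglyMeasurable_nonlocalGradient hΩ hρ, ?_⟩ h.memLp_gradient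
  exact (h.eLpNorm_nonlocalGradient_le hΩ hρ).trans_lt
    (ENNReal.mul_lt_top (ENNReal.natCast_lt_top D) h.memLp_gradient.eLpNorm_lt_top)

end IsTestLimit

/-! ### Remainders on the product -/

/-- The first marginal of `μ.prod ν` is `ν univ • μ`. -/
lemma eLpNorm_comp_fst {α β F : Type*} [MeasurableSpace α] [MeasurableSpace β]
    [NormedAddCommGroup F] {μ : Measure α} {ν : Measure β} [IsFiniteMeasure ν] {p : ENNReal}
    (hp : p ≠ ⊤) {f : α → F} (hf : AEStronglyMeasurable f μ) :
    eLpNorm (fun q : α × β => f q.1) p (μ.prod ν) = ν univ ^ (1 / p).toReal * eLpNorm f p μ := by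
  have h := eLpNorm_map_measure (p := p) (g := f) (f := Prod.fst) (μ := μ.prod ν)
    (by simpa using hf.smul_measure (ν univ)) (by fun_prop)
  rw [Measure.map_fst_prod, eLpNorm_smul_measure_of_ne_top hp, smul_eq_mul] at h
  exact h.symm

/-- `u` cancels, so only the difference of the two gradient fields has to be controlled. -/
lemma remainder_sub_remainder (u : E D → ℝ) (G H : E D → E D) (x₀ x : E D) :
    remainder u H x₀ x - remainder u G x₀ x = - inner ℝ (x - x₀) (H x₀ - G x₀) := by
  rw [remainder, remainder, affineApprox, affineApprox, inner_sub_right]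
  ring

lemma ae_norm_remainder_sub_remainder_le (hΩ : MeasurableSet Ω) {R : ℝ}
    (hR : ∀ x ∈ Ω, ‖x‖ ≤ R) (u : E D → ℝ) (G H : E D → E D) :
    ∀ᵐ p ∂((volume.restrict Ω).prod (volume.restrict Ω)),
      ‖remainder u H p.1 p.2 - remainder u G p.1 p.2‖ ≤ 2 * R * ‖H p.1 - G p.1‖ := by
  rw [Measure.prod_restrict]
  filter_upwards [ae_restrict_mem (hΩ.prod hΩ)] with p hp
  rw [remainder_sub_remainder, norm_neg, inner_sub_right]
  exact norm_inner_sub_le hR hp.1 hp.2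

lemma aestronglyMeasurable_remainder_sub_remainder
    (h : AEStronglyMeasurable (fun x => H x - G x) (volume.restrict Ω)) :
    AEStronglyMeasurable
      (fun p : E D × E D => remainder u H p.1 p.2 - remainder u G p.1 p.2)
      ((volume.restrict Ω).prod (volume.restrict Ω)) := by
  simp_rw [remainder_sub_remainder]
  have hd : AEStronglyMeasurable (fun p : E D × E D => p.2 - p.1)
      ((volume.restrict Ω).prod (volume.restrict Ω)) :=
    Measurable.aestronglyMeasurable (by fun_prop)
  exact (hd.inner h.comp_fst).neg

lemma memLp_remainder_sub_remainder (hΩ : MeasurableSet Ω) (hΩb : Bornology.IsBounded Ω)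
    (h : MemLp (fun x => H x - G x) 2 (volume.restrict Ω)) :
    MemLp (fun p : E D × E D => remainder u H p.1 p.2 - remainder u G p.1 p.2) 2
      ((volume.restrict Ω).prod (volume.restrict Ω)) := by
  obtain ⟨R, -, hR⟩ := hΩb.exists_pos_norm_le
  have : IsFiniteMeasure (volume.restrict Ω) :=
    isFiniteMeasure_restrict.2 hΩb.measure_lt_top.ne
  exact (h.comp_fst (volume.restrict Ω)).of_le_mul
    (aestronglyMeasurable_remainder_sub_remainder h.1)
    (ae_norm_remainder_sub_remainder_le hΩ hR u G H)

lemma tendsto_eLpNorm_remainder_sub_remainder (hΩ : MeasurableSet Ω)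
    (hΩb : Bornology.IsBounded Ω) {F : ℕ → E D → E D}
    (hF : ∀ n, MemLp (fun x => F n x - G x) 2 (volume.restrict Ω))
    (h : Tendsto (fun n => eLpNorm (fun x => F n x - G x) 2 (volume.restrict Ω)) atTop (𝓝 0)) :
    Tendsto (fun n => eLpNorm
      (fun p : E D × E D => remainder u (F n) p.1 p.2 - remainder u G p.1 p.2) 2
      ((volume.restrict Ω).prod (volume.restrict Ω))) atTop (𝓝 0) := by
  obtain ⟨R, -, hR⟩ := hΩb.exists_pos_norm_le
  have : IsFiniteMeasure (volume.restrict Ω) :=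
    isFiniteMeasure_restrict.2 hΩb.measure_lt_top.ne
  set c : ENNReal := ENNReal.ofReal (2 * R)
    * (volume.restrict Ω) univ ^ (1 / (2 : ENNReal)).toReal with hc
  have hcfin : c ≠ ⊤ := ENNReal.mul_ne_top ENNReal.ofReal_ne_top
    (ENNReal.rpow_ne_top_of_nonneg (by positivity) (measure_ne_top _ _))
  have h0 : Tendsto (fun n => c * eLpNorm (fun x => F n x - G x) 2 (volume.restrict Ω)) atTop
      (𝓝 0) := by
    simpa using ENNReal.Tendsto.const_mul h (Or.inr hcfin)
  refine tendsto_of_tendsto_of_tendsto_of_le_of_le tendsto_const_nhds h0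
    (fun n => zero_le) fun n => ?_
  refine (eLpNorm_le_mul_eLpNorm_of_ae_le_mul
    (ae_norm_remainder_sub_remainder_le hΩ hR u G (F n)) 2).trans_eq ?_
  rw [eLpNorm_comp_fst ENNReal.ofNat_ne_top (hF n).1, hc, mul_assoc]

end NonlocalTaylor

/-! ### Main theorem -/

theorem mainTheorem9 (D : ℕ) (hD : 0 < D) (Ω : Set (NonlocalTaylor.E D)) (hΩ : IsOpen Ω)
    (hΩb : Bornology.IsBounded Ω) (ρ : ℕ → NonlocalTaylor.E D → ℝ)
    (hρ : NonlocalTaylor.IsKernelSequence ρ) :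
    (∀ u : NonlocalTaylor.E D → ℝ, NonlocalTaylor.MemC1c Ω u →
      (∀ n, ∀ x ∈ Ω, NonlocalTaylor.HasNonlocalGradientAt (ρ n) Ω u x
        (NonlocalTaylor.nonlocalGradient (ρ n) Ω u x)) ∧
      TendstoUniformlyOn
        (fun n (p : NonlocalTaylor.E D × NonlocalTaylor.E D) =>
          NonlocalTaylor.affineApprox u (NonlocalTaylor.nonlocalGradient (ρ n) Ω u) p.1 p.2)
        (fun p => NonlocalTaylor.affineApprox u (gradient u) p.1 p.2) atTop (Ω ×ˢ Ω) ∧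
      TendstoUniformlyOn
        (fun n (p : NonlocalTaylor.E D × NonlocalTaylor.E D) =>
          NonlocalTaylor.remainder u (NonlocalTaylor.nonlocalGradient (ρ n) Ω u) p.1 p.2)
        (fun p => NonlocalTaylor.remainder u (gradient u) p.1 p.2) atTop (Ω ×ˢ Ω)) ∧
    (∀ (u : NonlocalTaylor.E D → ℝ) (G : NonlocalTaylor.E D → NonlocalTaylor.E D),
      NonlocalTaylor.MemH10 Ω u → NonlocalTaylor.IsWeakGradient Ω u G →
      (∀ n, ∀ᵐ x ∂(volume.restrict Ω), NonlocalTaylor.HasNonlocalGradientAt (ρ n) Ω u x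
        (NonlocalTaylor.nonlocalGradient (ρ n) Ω u x)) ∧
      (∀ n, MemLp (fun p : NonlocalTaylor.E D × NonlocalTaylor.E D =>
          NonlocalTaylor.remainder u (NonlocalTaylor.nonlocalGradient (ρ n) Ω u) p.1 p.2
            - NonlocalTaylor.remainder u G p.1 p.2)
        2 ((volume.restrict Ω).prod (volume.restrict Ω))) ∧
      Tendsto (fun n => eLpNorm (fun p : NonlocalTaylor.E D × NonlocalTaylor.E D =>
          NonlocalTaylor.remainder u (NonlocalTaylor.nonlocalGradient (ρ n) Ω u) p.1 p.2
            - NonlocalTaylor.remainder u G p.1 p.2)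
        2 ((volume.restrict Ω).prod (volume.restrict Ω))) atTop (𝓝 0)) := by
  have hfin : volume Ω ≠ ⊤ := hΩb.measure_lt_top.ne
  refine ⟨fun u hu => ?_, fun u G hu hG => ?_⟩
  · have h := hu.tendstoUniformlyOn_nonlocalGradient hD hΩ hρ
    exact ⟨fun n x hx => NonlocalTaylor.hasNonlocalGradientAt_of_integrableOn
        (hu.integrableOn_nonlocalIntegrand hΩ (hρ.density n) hx),
      NonlocalTaylor.tendstoUniformlyOn_affineApprox hΩb u h,
      NonlocalTaylor.tendstoUniformlyOn_remainder hΩb u h⟩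
  · have h := hu.isTestLimit hΩ hG
    have hL := fun n => h.memLp_nonlocalGradient_sub hΩ.measurableSet (hρ.density n)
    refine ⟨fun n => ?_,
      fun n => NonlocalTaylor.memLp_remainder_sub_remainder hΩ.measurableSet hΩb (hL n),
      NonlocalTaylor.tendsto_eLpNorm_remainder_sub_remainder hΩ.measurableSet hΩb hL
        (h.tendsto_eLpNorm_nonlocalGradient_sub hD hΩ hfin hρ)⟩
    filter_upwards [h.ae_integrableOn hΩ.measurableSet (hρ.density n)] with x hx
    exact NonlocalTaylor.hasNonlocalGradientAt_of_integrableOn hx
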